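/- Let $D(u)=6\left(u-\tfrac{7}{12}\right)\left(u-\tfrac34\right)$, $R(u)=5u(1-u)\left(u-\tfrac15\right)$ and $F(u)=2u^3-4u^2+\tfrac{21}{8}u$, so that $F'=D$. Let $\varepsilon>0$ and $c\in\mathbb{R}$, and let $(\bar U,\bar W,\bar P,\bar V):\mathbb{R}\to\mathbb{R}^4$ be a travelling wave, that is, a solution on all of $\mathbb{R}$ of $$\varepsilon\bar U'=\bar W,\qquad \varepsilon\bar W'=F(\bar U)-\bar V,\qquad \bar P'=-R(\bar U),\qquad \bar V'=\bar P-c\,\bar U,$$ that tends to the fixed point $(1,0,c,F(1))$ as $\zeta\to-\infty$ and to the fixed point $(0,0,0,0)$ as $\zeta\to+\infty$. Thus $\bar U(x-ct)$ is a travelling wave solution of $U_t=(D(U)U_x)_x+R(U)-\varepsilon^2U_{xxxx}$. Let $\mathcal L$ be the linearised operator $$\mathcal L U=cU_\zeta+(D(\bar U)U)_{\zeta\zeta}+R'(\bar U)U-\varepsilon^2U_{\zeta\zeta\zeta\zeta},$$ regarded as an unbounded operator on $L^2(\mathbb{R};\mathbb{C})$ with domain $H^4(\mathbb{R};\mathbb{C})$,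 and let $\sigma(\mathcal L)$ be its spectrum. Then there exist $\beta<0$ and a simple closed curve $K\subset\mathbb{C}$ such that $\sigma(\mathcal L)\cap\{\lambda\in\mathbb{C}:\operatorname{Re}\lambda>\beta\}$ is contained in the interior of $K$ (the bounded region enclosed by $K$). In particular, every eigenvalue $\lambda$ of $\mathcal L$ with $\operatorname{Re}\lambda>\beta$ lies in the interior of $K$. -/

import Mathlib

open MeasureTheory TemperedDistribution Filter Topology
open scoped SchwartzMap ENNReal

namespace ShockFront

noncomputable section

/-! ### The reaction-diffusion equation and its travelling waves -/

/-- The nonlinear diffusivity `D(u) = 6 (u - 7/12) (u - 3/4)`. -/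
def diffusion (u : ℝ) : ℝ := 6 * (u - 7 / 12) * (u - 3 / 4)

/-- The bistable reaction term `R(u) = 5 u (1 - u) (u - 1/5)`. -/
def reaction (u : ℝ) : ℝ := 5 * u * (1 - u) * (u - 1 / 5)

/-- The antiderivative `F(u) = 2 u³ - 4 u² + (21/8) u` of the diffusivity. -/
def potential (u : ℝ) : ℝ := 2 * u ^ 3 - 4 * u ^ 2 + 21 / 8 * u

theorem hasDerivAt_potential (u : ℝ) : HasDerivAt potential (diffusion u) u := by
  have h := (((hasDerivAt_id u).pow 3).const_mul 2).sub (((hasDerivAt_id u).pow 2).const_mul 4)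
  have h' := h.add ((hasDerivAt_id u).const_mul (21 / 8))
  refine (h'.congr_deriv ?_)
  simp only [diffusion, id]
  push_cast
  ring

/-- `(U, W, P, V)` is a travelling wave with regularisation parameter `ε` and speed `c`: a solution
on the whole line of the system
`ε U' = W`, `ε W' = F(U) - V`, `P' = -R(U)`, `V' = P - c U`
that connects the fixed point `(1, 0, c, F(1))` at `ζ = -∞` to the fixed point `(0, 0, 0, 0)` at
`ζ = +∞`. -/
structure IsTravellingWave (ε c : ℝ) (U W P V : ℝ → ℝ) : Prop where
  eqU : ∀ ζ, HasDerivAt (fun s => ε * U s) (W ζ) ζ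
  eqW : ∀ ζ, HasDerivAt (fun s => ε * W s) (potential (U ζ) - V ζ) ζ
  eqP : ∀ ζ, HasDerivAt P (-reaction (U ζ)) ζ
  eqV : ∀ ζ, HasDerivAt V (P ζ - c * U ζ) ζ
  limU_bot : Tendsto U atBot (𝓝 1)
  limW_bot : Tendsto W atBot (𝓝 0)
  limP_bot : Tendsto P atBot (𝓝 c)
  limV_bot : Tendsto V atBot (𝓝 (potential 1))
  limU_top : Tendsto U atTop (𝓝 0)
  limW_top : Tendsto W atTop (𝓝 0)
  limP_top : Tendsto P atTop (𝓝 0)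
  limV_top : Tendsto V atTop (𝓝 0)

/-! ### The linearised operator -/

/-- The Hilbert space `L²(ℝ; ℂ)`. -/
abbrev L2 : Type := Lp ℂ 2 (volume : Measure ℝ)

/-- `IsMul a u v` : the element `v` of `L²(ℝ; ℂ)` is the pointwise product of the real coefficient
`a` and `u`. -/
def IsMul (a : ℝ → ℝ) (u v : L2) : Prop := ∀ᵐ ζ : ℝ, v ζ = (a ζ : ℂ) * u ζ

/-- `(u, g)` lies on the graph of
`L u = c u' + (D(U) u)'' + R'(U) u - ε² u''''`:
the function `u` is in the Sobolev space `H⁴(ℝ; ℂ)`, and `g ∈ L²(ℝ; ℂ)` is equal to the right-hand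
side in the sense of distributions. Here `v` is the product `D(U) u` and `w` the product `R'(U) u`.
-/
def IsLinearised (ε c : ℝ) (U : ℝ → ℝ) (u g : L2) : Prop :=
  MemSobolev 4 2 (u : 𝓢'(ℝ, ℂ)) ∧
    ∃ v w : L2, IsMul (fun ζ => diffusion (U ζ)) u v ∧
      IsMul (fun ζ => deriv reaction (U ζ)) u w ∧
      (g : 𝓢'(ℝ, ℂ)) =
        (c : ℂ) • derivCLM ℂ (u : 𝓢'(ℝ, ℂ))
          + derivCLM ℂ (derivCLM ℂ (v : 𝓢'(ℝ, ℂ)))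
          + (w : 𝓢'(ℝ, ℂ))
          - ((ε ^ 2 : ℝ) : ℂ) •
            derivCLM ℂ (derivCLM ℂ (derivCLM ℂ (derivCLM ℂ (u : 𝓢'(ℝ, ℂ)))))

theorem IsMul.add {a : ℝ → ℝ} {u v u' v' : L2} (h : IsMul a u v) (h' : IsMul a u' v') :
    IsMul a (u + u') (v + v') := by
  unfold IsMul at *
  filter_upwards [h, h', Lp.coeFn_add u u', Lp.coeFn_add v v'] with ζ h1 h2 h3 h4
  rw [h3, h4, Pi.add_apply, Pi.add_apply, h1, h2, mul_add]

theorem IsMul.smul {a : ℝ → ℝ} {u v : L2} (k : ℂ) (h : IsMul a u v) :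
    IsMul a (k • u) (k • v) := by
  unfold IsMul at *
  filter_upwards [h, Lp.coeFn_smul k u, Lp.coeFn_smul k v] with ζ h1 h3 h4
  rw [h3, h4, Pi.smul_apply, Pi.smul_apply, h1, smul_eq_mul, smul_eq_mul, mul_left_comm]

theorem IsMul.zero (a : ℝ → ℝ) : IsMul a 0 0 := by
  simpa using IsMul.smul (a := a) (u := 0) (v := 0) 0 (by
    unfold IsMul
    filter_upwards [Lp.coeFn_zero ℂ 2 (volume : Measure ℝ)] with ζ h
    simp)

theorem IsMul.eq_zero {a : ℝ → ℝ} {v : L2} (h : IsMul a 0 v) : v = 0 := by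
  rw [Lp.eq_zero_iff_ae_eq_zero]
  unfold IsMul at h
  filter_upwards [h, Lp.coeFn_zero ℂ 2 (volume : Measure ℝ)] with ζ h1 h2
  simp [h1]

theorem coe_add (u v : L2) :
    ((u + v : L2) : 𝓢'(ℝ, ℂ)) = (u : 𝓢'(ℝ, ℂ)) + (v : 𝓢'(ℝ, ℂ)) :=
  map_add (Lp.toTemperedDistributionCLM ℂ (volume : Measure ℝ) 2) u v

theorem coe_smul (k : ℂ) (u : L2) :
    ((k • u : L2) : 𝓢'(ℝ, ℂ)) = k • (u : 𝓢'(ℝ, ℂ)) :=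
  map_smul (Lp.toTemperedDistributionCLM ℂ (volume : Measure ℝ) 2) k u

theorem coe_zero : ((0 : L2) : 𝓢'(ℝ, ℂ)) = 0 :=
  map_zero (Lp.toTemperedDistributionCLM ℂ (volume : Measure ℝ) 2)

theorem distrib_smul_zero (a : ℂ) : a • (0 : 𝓢'(ℝ, ℂ)) = 0 :=
  smul_zero (A := 𝓢'(ℝ, ℂ)) a

/-- The graph of the linearised operator, as a subspace of `L² × L²`. -/
def linearisedGraph (ε c : ℝ) (U : ℝ → ℝ) : Submodule ℂ (L2 × L2) where
  carrier := {x | IsLinearised ε c U x.1 x.2}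
  add_mem' := by
    rintro ⟨u, g⟩ ⟨u', g'⟩ ⟨hs, v, w, hv, hw, h⟩ ⟨hs', v', w', hv', hw', h'⟩
    refine ⟨?_, v + v', w + w', hv.add hv', hw.add hw', ?_⟩
    · simpa only [Prod.mk_add_mk, coe_add] using hs.add hs'
    · simp only [Prod.mk_add_mk, coe_add, map_add, smul_add] at h h' ⊢
      rw [h, h']
      abel
  zero_mem' := by
    refine ⟨?_, 0, 0, IsMul.zero _, IsMul.zero _, ?_⟩
    · simpa only [Prod.fst_zero, coe_zero] using memSobolev_fun_zero ℝ ℂ 4 2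
    · simp only [Prod.fst_zero, Prod.snd_zero, coe_zero, map_zero, add_zero]
      rw [distrib_smul_zero, distrib_smul_zero, sub_zero]
  smul_mem' := by
    rintro k ⟨u, g⟩ ⟨hs, v, w, hv, hw, h⟩
    refine ⟨?_, k • v, k • w, hv.smul k, hw.smul k, ?_⟩
    · simpa only [Prod.smul_mk, coe_smul] using hs.smul k
    · simp only [Prod.smul_mk, coe_smul, map_smul] at h ⊢
      rw [h, smul_sub, smul_add, smul_add, smul_comm k (c : ℂ), smul_comm k ((ε ^ 2 : ℝ) : ℂ)]

/-- The linearised operator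
`L u = c u' + (D(U) u)'' + R'(U) u - ε² u''''`
about the wave profile `U`, as an unbounded operator on `L²(ℝ; ℂ)`. Its domain consists of the
`u ∈ H⁴(ℝ; ℂ)` with `L u ∈ L²(ℝ; ℂ)`, which is all of `H⁴(ℝ; ℂ)` for a travelling wave, because
the coefficients are then smooth with bounded derivatives. -/
def linearisedOperator (ε c : ℝ) (U : ℝ → ℝ) : L2 →ₗ.[ℂ] L2 :=
  (linearisedGraph ε c U).toLinearPMap

theorem linearisedGraph_single_valued (ε c : ℝ) (U : ℝ → ℝ) (x : L2 × L2)
    (hx : x ∈ linearisedGraph ε c U) (hx' : x.1 = 0) : x.2 = 0 := by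
  obtain ⟨u, g⟩ := x
  obtain ⟨-, v, w, hv, hw, h⟩ := hx
  simp only at hx' h hv hw ⊢
  subst hx'
  rw [hv.eq_zero, hw.eq_zero] at h
  simp only [coe_zero, map_zero, add_zero] at h
  rw [distrib_smul_zero, distrib_smul_zero, sub_zero] at h
  have hk := Lp.ker_toTemperedDistributionCLM_eq_bot (F := ℂ) (μ := (volume : Measure ℝ)) (p := 2)
  rw [LinearMap.ker_eq_bot'] at hk
  exact hk g h

/-- The linearised operator has the intended graph. -/
theorem mem_graph_linearisedOperator (ε c : ℝ) (U : ℝ → ℝ) (u g : L2) :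
    (u, g) ∈ (linearisedOperator ε c U).graph ↔ IsLinearised ε c U u g := by
  rw [linearisedOperator,
    Submodule.toLinearPMap_graph_eq _ (linearisedGraph_single_valued ε c U)]
  rfl

/-! ### Spectra of unbounded operators -/

/-- The resolvent set of an unbounded operator `T`: all `z` such that `z - T`, as a map from the
domain of `T` to the whole space, has a bounded two-sided inverse. -/
def resolventSet {X : Type*} [NormedAddCommGroup X] [NormedSpace ℂ X] (T : X →ₗ.[ℂ] X) : Set ℂ :=
  {z | ∃ S : X →L[ℂ] X,
    (∀ f : X, ∃ h : S f ∈ T.domain, z • S f - T ⟨S f, h⟩ = f) ∧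
    ∀ u : T.domain, S (z • (u : X) - T u) = u}

/-- The spectrum of an unbounded operator: the complement of the resolvent set. -/
def spectrum {X : Type*} [NormedAddCommGroup X] [NormedSpace ℂ X] (T : X →ₗ.[ℂ] X) : Set ℂ :=
  (resolventSet T)ᶜ

/-- The set of eigenvalues of an unbounded operator. -/
def pointSpectrum {X : Type*} [NormedAddCommGroup X] [NormedSpace ℂ X] (T : X →ₗ.[ℂ] X) : Set ℂ :=
  {z | ∃ u : T.domain, u ≠ 0 ∧ T u = z • (u : X)}

/-! ### Simple closed curves -/

/-- A simple closed curve in the plane: an injective continuous image of the circle. -/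
def IsSimpleClosedCurve (K : Set ℂ) : Prop :=
  ∃ γ : Circle → ℂ, Continuous γ ∧ Function.Injective γ ∧ Set.range γ = K

/-- The interior of a simple closed curve `K`: the points off `K` whose connected component in the
complement of `K` is bounded. -/
def curveInterior (K : Set ℂ) : Set ℂ :=
  {z | z ∉ K ∧ Bornology.IsBounded (connectedComponentIn Kᶜ z)}

end

end ShockFront

/-! The operator is `-ε² ∂⁴` plus terms of order at most two, and such a perturbation cannot push
spectrum far out into a half-plane `Re z > β`. On the Fourier side `z - L` is multiplication by
`m(ξ) = z + ε² (2πξ)⁴` minus the contribution of `c u' + (A u)'' + B u`, where `A` and `B` are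
multiplication by `D(U)` and `R'(U)`. If `Re z > -1` and `|z|` is large, then `|m(ξ)|` dominates any
prescribed multiple of `1 + ξ²` (`norm_add_ofReal_ge`). After division by `m` the perturbation has
norm at most `1/4` on `L²`, and a Neumann series inverts `z - L` (`exists_solutionOperator`). The
spectrum to the right of `Re z = -1` thus lies in a disc about the origin, and its boundary circle
serves as the curve. Nothing is special about `-1`.

The Neumann series only produces solutions in `L²`. That they lie in the domain `H⁴` is elliptic
regularity (`memSobolev_four_of_fourier_eq`), which needs multiplication by `D(U)` to preserve `H²`.
This holds because polynomials in `U, W, P, V` are bounded and, by the wave system, closed under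
differentiation. -/

namespace ShockFront

/-! ### Multiplication operators and the linearised operator on the Fourier side. -/

open FourierTransform Complex

/-- Multiplication by a bounded measurable function is a bounded operator on `L²`. -/
theorem exists_mulOperator {m : ℝ → ℂ} (hm : AEStronglyMeasurable m volume) {C : ℝ} (hC0 : 0 ≤ C)
    (hC : ∀ x, ‖m x‖ ≤ C) :
    ∃ M : L2 →L[ℂ] L2, (∀ u : L2, ∀ᵐ x, M u x = m x * u x) ∧ ‖M‖ ≤ C := by
  have key (u : L2) : MemLp (fun x => m x * u x) 2 volume := by
    refine (Lp.memLp u).of_le_mul (c := C) (hm.mul (Lp.memLp u).1) (ae_of_all _ fun x => ?_)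
    rw [norm_mul]
    exact mul_le_mul_of_nonneg_right (hC x) (norm_nonneg _)
  let M₀ : L2 →ₗ[ℂ] L2 :=
    { toFun := fun u => (key u).toLp _
      map_add' := fun u v => by
        refine Lp.ext ?_
        filter_upwards [(key u).coeFn_toLp, (key v).coeFn_toLp, (key (u + v)).coeFn_toLp,
          Lp.coeFn_add u v, Lp.coeFn_add ((key u).toLp _) ((key v).toLp _)] with x h1 h2 h3 h4 h5
        rw [h3, h5, Pi.add_apply, h1, h2, h4, Pi.add_apply, mul_add]
      map_smul' := fun k u => by
        refine Lp.ext ?_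
        filter_upwards [(key u).coeFn_toLp, (key (k • u)).coeFn_toLp,
          Lp.coeFn_smul k u, Lp.coeFn_smul k ((key u).toLp _)] with x h1 h3 h4 h5
        rw [RingHom.id_apply, h3, h5, Pi.smul_apply, h1, h4, Pi.smul_apply, smul_eq_mul,
          smul_eq_mul, mul_left_comm] }
  have hM (u : L2) : ∀ᵐ x, M₀ u x = m x * u x := (key u).coeFn_toLp
  have hb (u : L2) : ‖M₀ u‖ ≤ C * ‖u‖ := by
    refine Lp.norm_le_mul_norm_of_ae_le_mul ?_
    filter_upwards [hM u] with x hx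
    rw [hx, norm_mul]
    exact mul_le_mul_of_nonneg_right (hC x) (norm_nonneg _)
  exact ⟨M₀.mkContinuous C hb, hM, M₀.mkContinuous_norm_le hC0 hb⟩

theorem integrable_schwartz_mul (φ : 𝓢(ℝ, ℂ)) (u : L2) :
    Integrable (fun x => φ x * u x) volume :=
  (φ.memLp 2 volume).integrable_mul (Lp.memLp u)

/-- A combination of `L²` functions with coefficients of temperate growth vanishes as a tempered
distribution if and only if it vanishes almost everywhere. -/
theorem sum_smulLeftCLM_eq_zero_iff {ι : Type*} [Fintype ι] {σ : ι → ℝ → ℂ}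
    (hσ : ∀ i, (σ i).HasTemperateGrowth) (a : ι → L2) :
    ∑ i, smulLeftCLM ℂ (σ i) (a i : 𝓢'(ℝ, ℂ)) = 0 ↔ ∀ᵐ x : ℝ, ∑ i, σ i x * a i x = 0 := by
  have happ (φ : 𝓢(ℝ, ℂ)) : (∑ i, smulLeftCLM ℂ (σ i) (a i : 𝓢'(ℝ, ℂ))) φ =
      ∫ x, φ x * ∑ i, σ i x * a i x := by
    simp_rw [Finset.mul_sum]
    rw [integral_finsetSum]
    · rw [sum_apply]
      refine Finset.sum_congr rfl fun i _ => ?_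
      rw [smulLeftCLM_apply_apply, Lp.toTemperedDistribution_apply]
      refine integral_congr_ae (ae_of_all _ fun x => ?_)
      simp only [SchwartzMap.smulLeftCLM_apply_apply (hσ i), smul_eq_mul]
      ring
    · intro i _
      refine (integrable_schwartz_mul (SchwartzMap.smulLeftCLM ℂ (σ i) φ) (a i)).congr
        (ae_of_all _ fun x => ?_)
      simp only [SchwartzMap.smulLeftCLM_apply_apply (hσ i), smul_eq_mul]
      ring
  constructor
  · intro h
    refine ae_eq_zero_of_integral_contDiff_smul_eq_zero ?_ fun g hg hc => ?_
    · have (s : Finset ι) : LocallyIntegrable (fun x => ∑ i ∈ s, σ i x * a i x) volume := by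
        classical
        induction s using Finset.induction_on with
        | empty => simpa using locallyIntegrable_const (0 : ℂ)
        | insert i s hi ih =>
          simp_rw [Finset.sum_insert hi]
          exact (((Lp.memLp (a i)).locallyIntegrable (by norm_num)).continuous_mul
            (hσ i).1.continuous).add ih
      exact this Finset.univ
    -- The test functions of the fundamental lemma are real-valued; included into `ℂ` they are
    -- Schwartz functions, on which the distribution vanishes.
    · have hg₁ : HasCompactSupport (Complex.ofRealCLM ∘ g) := hc.comp_left rfl
      have hg₂ : ContDiff ℝ _ (Complex.ofRealCLM ∘ g) := Complex.ofRealCLM.contDiff.comp hg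
      have := happ (hg₁.toSchwartzMap hg₂)
      rw [h] at this
      simpa using this.symm
  · intro h
    ext φ
    rw [happ]
    refine (integral_eq_zero_of_ae ?_)
    filter_upwards [h] with x hx
    simp [hx]

theorem distrib_neg_one_smul (f : 𝓢'(ℝ, ℂ)) : (-1 : ℂ) • f = -f :=
  neg_one_smul (M := 𝓢'(ℝ, ℂ)) ℂ f

theorem smulLeftCLM_eq_iff {σ : ℝ → ℂ} (hσ : σ.HasTemperateGrowth) (a b : L2) :
    smulLeftCLM ℂ σ (a : 𝓢'(ℝ, ℂ)) = (b : 𝓢'(ℝ, ℂ)) ↔ ∀ᵐ x : ℝ, b x = σ x * a x := by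
  have h := sum_smulLeftCLM_eq_zero_iff (σ := ![σ, fun _ => -1]) (a := ![a, b])
    (by intro i; fin_cases i <;> simp [hσ])
  simp only [Fin.sum_univ_two, Matrix.cons_val_zero, Matrix.cons_val_one, smulLeftCLM_const,
    distrib_neg_one_smul, neg_one_mul, ← sub_eq_add_neg, sub_eq_zero] at h
  rw [h]
  exact eventually_congr (ae_of_all _ fun x => eq_comm)

theorem derivCLM_eq_lineDerivOp (f : 𝓢'(ℝ, ℂ)) :
    derivCLM ℂ f = LineDeriv.lineDerivOp (1 : ℝ) f := by
  ext φ
  rw [derivCLM_apply_apply, lineDerivOp_apply_apply]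
  rfl

/-- The Fourier symbol of the derivative. -/
noncomputable def derivSymbol (ξ : ℝ) : ℂ := 2 * Real.pi * I * ξ

theorem hasTemperateGrowth_derivSymbol : derivSymbol.HasTemperateGrowth := by
  unfold derivSymbol
  fun_prop

theorem fourier_derivCLM (f : 𝓢'(ℝ, ℂ)) :
    𝓕 (derivCLM ℂ f) = smulLeftCLM ℂ derivSymbol (𝓕 f) := by
  rw [derivCLM_eq_lineDerivOp, fourier_lineDerivOp_eq, ← smul_apply, ← smulLeftCLM_smul]
  · congr 2
    ext ξ
    simp [derivSymbol]
  · fun_prop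

theorem fourier_injective {f g : 𝓢'(ℝ, ℂ)} : 𝓕 f = 𝓕 g ↔ f = g :=
  (fourierEquiv ℂ 𝓢'(ℝ, ℂ)).injective.eq_iff

/-- The linearised operator on the Fourier side. -/
theorem isLinearised_iff (ε c : ℝ) (U : ℝ → ℝ) (u g : L2) :
    IsLinearised ε c U u g ↔ MemSobolev 4 2 (u : 𝓢'(ℝ, ℂ)) ∧
      ∃ v w : L2, IsMul (fun ζ => diffusion (U ζ)) u v ∧
      IsMul (fun ζ => deriv reaction (U ζ)) u w ∧
      ∀ᵐ ξ : ℝ, (𝓕 g : L2) ξ = (c * derivSymbol ξ - ε ^ 2 * derivSymbol ξ ^ 4) * (𝓕 u : L2) ξ +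
        derivSymbol ξ ^ 2 * (𝓕 v : L2) ξ + (𝓕 w : L2) ξ := by
  unfold IsLinearised
  refine and_congr_right fun _ => exists_congr fun v => exists_congr fun w =>
    and_congr_right fun _ => and_congr_right fun _ => ?_
  have hs := hasTemperateGrowth_derivSymbol
  -- The equation, with `g` moved to the other side, is the vanishing of one combination of the
  -- transforms of `u, v, w, g`.
  have h := sum_smulLeftCLM_eq_zero_iff
    (σ := ![fun ξ => c * derivSymbol ξ - ε ^ 2 * derivSymbol ξ ^ 4, fun ξ => derivSymbol ξ ^ 2,
      fun _ => 1, fun _ => -1]) (a := ![(𝓕 u : L2), 𝓕 v, 𝓕 w, 𝓕 g])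
    (by intro i; fin_cases i <;> simp <;> fun_prop)
  simp only [Fin.sum_univ_four, Matrix.cons_val, smulLeftCLM_const,
    distrib_neg_one_smul, one_smul, neg_one_mul, one_mul, ← sub_eq_add_neg, sub_eq_zero] at h
  rw [eventually_congr (ae_of_all _ fun x => eq_comm), ← h, ← fourier_injective, eq_comm]
  have e1 : (fun ξ => c * derivSymbol ξ - ε ^ 2 * derivSymbol ξ ^ 4) =
      (c : ℂ) • derivSymbol - (ε ^ 2 : ℂ) •
        (derivSymbol * (derivSymbol * (derivSymbol * derivSymbol))) := by
    ext ξ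
    simp only [Pi.sub_apply, Pi.smul_apply, Pi.mul_apply, smul_eq_mul]
    ring
  have e2 : (fun ξ => derivSymbol ξ ^ 2) = derivSymbol * derivSymbol := by
    ext ξ
    rw [Pi.mul_apply, sq]
  rw [e1, e2, smulLeftCLM_sub, smulLeftCLM_smul, smulLeftCLM_smul]
  · simp only [sub_apply, smul_apply]
    rw [← smulLeftCLM_smulLeftCLM_apply, ← smulLeftCLM_smulLeftCLM_apply,
      ← smulLeftCLM_smulLeftCLM_apply, ← smulLeftCLM_smulLeftCLM_apply]
    · simp only [← Lp.fourier_toTemperedDistribution_eq, ← fourier_derivCLM]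
      have hh (f g : 𝓢'(ℝ, ℂ)) : 𝓕 (f - g) = 𝓕 f - 𝓕 g :=
        map_sub (fourierCLM ℂ 𝓢'(ℝ, ℂ)) f g
      simp only [← FourierTransform.fourier_smul, ← FourierTransform.fourier_add, ← hh]
      rw [show ((ε ^ 2 : ℝ) : ℂ) = (ε : ℂ) ^ 2 by push_cast; rfl]
      constructor <;> intro h <;> rw [← h] <;> congr 1 <;> abel
    all_goals fun_prop
  all_goals fun_prop

theorem memSobolev_iff_memLp (s : ℝ) (u : L2) : MemSobolev s 2 (u : 𝓢'(ℝ, ℂ)) ↔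
    MemLp (fun ξ : ℝ => (((1 + ξ ^ 2) ^ (s / 2) : ℝ) : ℂ) * (𝓕 u : L2) ξ) 2 volume := by
  rw [memSobolev_iff_exists_smulLeftCLM_fourier, Lp.fourier_toTemperedDistribution_eq]
  have ht : (fun ξ : ℝ => (((1 + ‖ξ‖ ^ 2) ^ (s / 2) : ℝ) : ℂ)).HasTemperateGrowth := by fun_prop
  simp_rw [smulLeftCLM_eq_iff ht]
  simp only [Real.norm_eq_abs, sq_abs]
  constructor
  · rintro ⟨f, hf⟩
    exact (memLp_congr_ae hf).1 (Lp.memLp f)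
  · intro h
    exact ⟨h.toLp _, h.coeFn_toLp⟩

/-! ### Smoothness and boundedness of the coefficients along the wave. -/

theorem exists_bound_of_tendsto {f : ℝ → ℝ} (hf : Continuous f) {a b : ℝ}
    (ha : Tendsto f atBot (𝓝 a)) (hb : Tendsto f atTop (𝓝 b)) : ∃ C, ∀ x, |f x| ≤ C := by
  obtain ⟨p, hp⟩ := eventually_atBot.1 (ha.abs.eventually (gt_mem_nhds (lt_add_one |a|)))
  obtain ⟨q, hq⟩ := eventually_atTop.1 (hb.abs.eventually (gt_mem_nhds (lt_add_one |b|)))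
  obtain ⟨C, hC⟩ := (isCompact_Icc (a := p) (b := q)).exists_bound_of_continuousOn hf.continuousOn
  refine ⟨max C (max (|a| + 1) (|b| + 1)), fun x => ?_⟩
  rcases le_total x p with h | h
  · exact (hp x h).le.trans ((le_max_left _ _).trans (le_max_right _ _))
  rcases le_total q x with h' | h'
  · exact (hq x h').le.trans ((le_max_right _ _).trans (le_max_right _ _))
  · exact (hC x ⟨h, h'⟩).trans (le_max_left _ _)

/-- A family of bounded functions closed under differentiation consists of functions of temperate
growth. -/
theorem hasTemperateGrowth_of_closed_deriv {S : Set (ℝ → ℝ)}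
    (hb : ∀ f ∈ S, ∃ C, ∀ x, |f x| ≤ C) (hd : ∀ f ∈ S, Differentiable ℝ f ∧ deriv f ∈ S)
    {f : ℝ → ℝ} (hf : f ∈ S) : f.HasTemperateGrowth := by
  have hi (n : ℕ) : iteratedDeriv n f ∈ S := by
    induction n with
    | zero => simpa using hf
    | succ n ih => rw [iteratedDeriv_succ]; exact (hd _ ih).2
  refine ⟨contDiff_of_differentiable_iteratedDeriv fun m _ => (hd _ (hi m)).1, fun n => ?_⟩
  obtain ⟨C, hC⟩ := hb _ (hi n)
  refine ⟨0, C, fun x => ?_⟩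
  rw [norm_iteratedFDeriv_eq_norm_iteratedDeriv]
  simpa using hC x

theorem deriv_reaction : deriv reaction = fun u => -15 * u ^ 2 + 12 * u - 1 := by
  funext u
  have h : reaction = fun u : ℝ => -5 * u ^ 3 + 6 * u ^ 2 - u := by
    funext u; simp only [reaction]; ring
  rw [h]
  have := (((hasDerivAt_pow 3 u).const_mul (-5)).add ((hasDerivAt_pow 2 u).const_mul 6)).sub
    (hasDerivAt_id u)
  refine (this.congr_deriv ?_).deriv
  push_cast
  ring

/-- The algebra of functions generated by the components of a travelling wave. -/
def waveAlgebra (U W P V : ℝ → ℝ) : Subalgebra ℝ (ℝ → ℝ) := Algebra.adjoin ℝ {U, W, P, V}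

section

variable {ε c : ℝ} {U W P V : ℝ → ℝ}

theorem mem_waveAlgebra :
    U ∈ waveAlgebra U W P V ∧ W ∈ waveAlgebra U W P V ∧ P ∈ waveAlgebra U W P V ∧
      V ∈ waveAlgebra U W P V :=
  ⟨Algebra.subset_adjoin (by simp), Algebra.subset_adjoin (by simp),
    Algebra.subset_adjoin (by simp), Algebra.subset_adjoin (by simp)⟩

/-- After division by `ε`, the right-hand sides of the wave system are polynomials in the unknowns,
so the generators have derivatives in the algebra; the Leibniz rule does the rest. -/
theorem IsTravellingWave.hasDerivAt_mem (hε : 0 < ε) (h : IsTravellingWave ε c U W P V)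
    {f : ℝ → ℝ} (hf : f ∈ waveAlgebra U W P V) :
    ∃ f' ∈ waveAlgebra U W P V, ∀ x, HasDerivAt f (f' x) x := by
  obtain ⟨mU, mW, mP, mV⟩ := mem_waveAlgebra (U := U) (W := W) (P := P) (V := V)
  have hc (r : ℝ) : (fun _ : ℝ => r) ∈ waveAlgebra U W P V :=
    Subalgebra.algebraMap_mem (waveAlgebra U W P V) r
  have scale {g g' : ℝ → ℝ} (hg : ∀ x, HasDerivAt (fun s => ε * g s) (g' x) x) (x : ℝ) :
      HasDerivAt g (ε⁻¹ * g' x) x := by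
    have := (hg x).const_mul ε⁻¹
    refine this.congr_of_eventuallyEq (Eventually.of_forall fun y => ?_)
    field_simp
  refine Algebra.adjoin_induction ?_ ?_ ?_ ?_ hf
  · rintro f (rfl | rfl | rfl | rfl)
    · exact ⟨_, mul_mem (hc ε⁻¹) mW, scale h.eqU⟩
    · refine ⟨_, mul_mem (hc ε⁻¹) (sub_mem ?_ mV), scale h.eqW⟩
      exact add_mem (sub_mem (mul_mem (hc 2) (pow_mem mU 3)) (mul_mem (hc 4) (pow_mem mU 2)))
        (mul_mem (hc (21 / 8)) mU)
    · refine ⟨_, neg_mem ?_, h.eqP⟩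
      exact mul_mem (mul_mem (mul_mem (hc 5) mU) (sub_mem (hc 1) mU)) (sub_mem mU (hc (1 / 5)))
    · exact ⟨_, sub_mem mP (mul_mem (hc c) mU), h.eqV⟩
  · exact fun r => ⟨_, zero_mem _, fun x => hasDerivAt_const x r⟩
  · rintro f g - - ⟨f', hf', df⟩ ⟨g', hg', dg⟩
    exact ⟨_, add_mem hf' hg', fun x => (df x).add (dg x)⟩
  · rintro f g hf hg ⟨f', hf', df⟩ ⟨g', hg', dg⟩
    exact ⟨_, add_mem (mul_mem hf' hg) (mul_mem hf hg'), fun x => (df x).mul (dg x)⟩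

/-- The generators are continuous with limits at both ends, and boundedness survives sums and
products. -/
theorem IsTravellingWave.bounded (hε : 0 < ε) (h : IsTravellingWave ε c U W P V)
    {f : ℝ → ℝ} (hf : f ∈ waveAlgebra U W P V) : ∃ C, ∀ x, |f x| ≤ C := by
  have cont {f : ℝ → ℝ} (hf : f ∈ waveAlgebra U W P V) : Continuous f := by
    obtain ⟨f', -, hd⟩ := h.hasDerivAt_mem hε hf
    exact continuous_iff_continuousAt.2 fun x => (hd x).continuousAt
  obtain ⟨mU, mW, mP, mV⟩ := mem_waveAlgebra (U := U) (W := W) (P := P) (V := V)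
  refine Algebra.adjoin_induction ?_ ?_ ?_ ?_ hf
  · rintro f (rfl | rfl | rfl | rfl)
    · exact exists_bound_of_tendsto (cont mU) h.limU_bot h.limU_top
    · exact exists_bound_of_tendsto (cont mW) h.limW_bot h.limW_top
    · exact exists_bound_of_tendsto (cont mP) h.limP_bot h.limP_top
    · exact exists_bound_of_tendsto (cont mV) h.limV_bot h.limV_top
  · exact fun r => ⟨|r|, fun x => le_rfl⟩
  · rintro f g - - ⟨A, hA⟩ ⟨B, hB⟩
    exact ⟨A + B, fun x => (abs_add_le _ _).trans (add_le_add (hA x) (hB x))⟩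
  · rintro f g - - ⟨A, hA⟩ ⟨B, hB⟩
    refine ⟨A * B, fun x => ?_⟩
    rw [Pi.mul_apply, abs_mul]
    exact mul_le_mul (hA x) (hB x) (abs_nonneg _) ((abs_nonneg _).trans (hA x))

theorem IsTravellingWave.differentiable (hε : 0 < ε) (h : IsTravellingWave ε c U W P V)
    {f : ℝ → ℝ} (hf : f ∈ waveAlgebra U W P V) :
    Differentiable ℝ f ∧ deriv f ∈ waveAlgebra U W P V := by
  obtain ⟨f', hf', hd⟩ := h.hasDerivAt_mem hε hf
  refine ⟨fun x => (hd x).differentiableAt, ?_⟩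
  rwa [show deriv f = f' from funext fun x => (hd x).deriv]

theorem IsTravellingWave.hasTemperateGrowth (hε : 0 < ε) (h : IsTravellingWave ε c U W P V)
    {f : ℝ → ℝ} (hf : f ∈ waveAlgebra U W P V) : f.HasTemperateGrowth :=
  hasTemperateGrowth_of_closed_deriv (S := waveAlgebra U W P V) (fun _ hg => h.bounded hε hg)
    (fun _ hg => h.differentiable hε hg) hf

theorem diffusion_mem_waveAlgebra : (fun ζ => diffusion (U ζ)) ∈ waveAlgebra U W P V := by
  have mU := (mem_waveAlgebra (U := U) (W := W) (P := P) (V := V)).1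
  have hc (r : ℝ) : (fun _ : ℝ => r) ∈ waveAlgebra U W P V :=
    Subalgebra.algebraMap_mem (waveAlgebra U W P V) r
  exact mul_mem (mul_mem (hc 6) (sub_mem mU (hc (7 / 12)))) (sub_mem mU (hc (3 / 4)))

theorem deriv_reaction_mem_waveAlgebra :
    (fun ζ => deriv reaction (U ζ)) ∈ waveAlgebra U W P V := by
  have mU := (mem_waveAlgebra (U := U) (W := W) (P := P) (V := V)).1
  have hc (r : ℝ) : (fun _ : ℝ => r) ∈ waveAlgebra U W P V :=
    Subalgebra.algebraMap_mem (waveAlgebra U W P V) r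
  rw [deriv_reaction]
  exact sub_mem (add_mem (mul_mem (hc (-15)) (pow_mem mU 2)) (mul_mem (hc 12) mU)) (hc 1)

end

/-! ### Circles and spectra -/

theorem isSimpleClosedCurve_sphere {r : ℝ} (hr : 0 < r) :
    IsSimpleClosedCurve (Metric.sphere (0 : ℂ) r) := by
  refine ⟨fun w => r * (w : ℂ), by fun_prop, fun w w' h => ?_, ?_⟩
  · exact Circle.ext (mul_left_cancel₀ (by exact_mod_cast hr.ne') h)
  · ext z
    simp only [Set.mem_range, mem_sphere_zero_iff_norm]
    constructor
    · rintro ⟨w, rfl⟩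
      rw [norm_mul, Circle.norm_coe, mul_one, Complex.norm_real, Real.norm_of_nonneg hr.le]
    · intro hz
      refine ⟨⟨z / r, mem_sphere_zero_iff_norm.2 ?_⟩, ?_⟩
      · rw [norm_div, hz, Complex.norm_real, Real.norm_of_nonneg hr.le, div_self hr.ne']
      · exact mul_div_cancel₀ z (by exact_mod_cast hr.ne')

/-- The norm takes the value `r` only on the sphere, so by the intermediate value theorem a
connected set that avoids the sphere and starts inside the ball never leaves it. -/
theorem ball_subset_curveInterior_sphere (r : ℝ) :
    Metric.ball (0 : ℂ) r ⊆ curveInterior (Metric.sphere (0 : ℂ) r) := by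
  intro z hz
  have hz' : ‖z‖ < r := by simpa using hz
  refine ⟨by simpa using hz'.ne, (Metric.isBounded_ball (x := (0 : ℂ)) (r := r)).subset ?_⟩
  have hc : IsPreconnected (connectedComponentIn (Metric.sphere (0 : ℂ) r)ᶜ z) :=
    isPreconnected_connectedComponentIn
  intro w hw
  by_contra hw'
  have hw'' : r ≤ ‖w‖ := by simpa using hw'
  obtain ⟨y, hy, hyr⟩ := hc.intermediate_value
    (mem_connectedComponentIn (by simpa using hz'.ne)) hw continuous_norm.continuousOn
    ⟨hz'.le, hw''⟩
  exact connectedComponentIn_subset _ _ hy (by simpa using hyr)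

theorem pointSpectrum_subset_spectrum {X : Type*} [NormedAddCommGroup X] [NormedSpace ℂ X]
    (T : X →ₗ.[ℂ] X) : pointSpectrum T ⊆ spectrum T := by
  rintro z ⟨u, hu, hz⟩ ⟨S, -, hS⟩
  refine hu (Subtype.ext ?_)
  rw [← hS u, hz, sub_self, map_zero]
  rfl

/-! ### Products of Sobolev functions with smooth bounded functions -/

/-- The product rule for a tempered distribution and a smooth function. -/
theorem derivCLM_smulLeftCLM {g g' : ℝ → ℂ} (hg : g.HasTemperateGrowth)
    (hg' : g'.HasTemperateGrowth) (hd : ∀ x, HasDerivAt g (g' x) x) (f : 𝓢'(ℝ, ℂ)) :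
    derivCLM ℂ (smulLeftCLM ℂ g f) = smulLeftCLM ℂ g' f + smulLeftCLM ℂ g (derivCLM ℂ f) := by
  ext φ
  rw [add_apply, derivCLM_apply_apply, smulLeftCLM_apply_apply, smulLeftCLM_apply_apply,
    smulLeftCLM_apply_apply, derivCLM_apply_apply, ← map_add]
  congr 1
  ext x
  have h : deriv (SchwartzMap.smulLeftCLM ℂ g φ) x = g' x * φ x + g x * deriv φ x := by
    have e : (SchwartzMap.smulLeftCLM ℂ g φ : ℝ → ℂ) = fun y => g y * φ y := by
      funext y
      rw [SchwartzMap.smulLeftCLM_apply_apply hg, smul_eq_mul]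
    rw [e]
    exact ((hd x).mul φ.differentiableAt.hasDerivAt).deriv
  simp only [map_neg, neg_apply, add_apply,
    SchwartzMap.smulLeftCLM_apply_apply hg, SchwartzMap.smulLeftCLM_apply_apply hg',
    SchwartzMap.derivCLM_apply, smul_eq_mul, h]
  ring

theorem memSobolev_zero_smulLeftCLM {g : ℝ → ℂ} (hg : g.HasTemperateGrowth)
    (hb : ∃ C, ∀ x, ‖g x‖ ≤ C) {f : 𝓢'(ℝ, ℂ)} (hf : MemSobolev 0 2 f) :
    MemSobolev 0 2 (smulLeftCLM ℂ g f) := by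
  rw [memSobolev_zero_iff] at hf ⊢
  obtain ⟨u, rfl⟩ := hf
  obtain ⟨C, hC⟩ := hb
  obtain ⟨M, hM, -⟩ := exists_mulOperator hg.1.continuous.aestronglyMeasurable
    ((norm_nonneg _).trans (hC 0)) hC
  exact ⟨M u, (smulLeftCLM_eq_iff hg u (M u)).2 (hM u)⟩

theorem memSobolev_derivCLM {s : ℝ} {f : 𝓢'(ℝ, ℂ)} (hf : MemSobolev (s + 1) 2 f) :
    MemSobolev s 2 (derivCLM ℂ f) := by
  rw [derivCLM_eq_lineDerivOp]
  simpa using hf.lineDerivOp (m := (1 : ℝ))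

theorem memSobolev_two_iff (u : L2) : MemSobolev 2 2 (u : 𝓢'(ℝ, ℂ)) ↔
    MemLp (fun ξ : ℝ => (1 + ξ ^ 2 : ℂ) * (𝓕 u : L2) ξ) 2 volume := by
  rw [memSobolev_iff_memLp]
  norm_num

theorem memSobolev_four_iff (u : L2) : MemSobolev 4 2 (u : 𝓢'(ℝ, ℂ)) ↔
    MemLp (fun ξ : ℝ => (1 + ξ ^ 2 : ℂ) ^ 2 * (𝓕 u : L2) ξ) 2 volume := by
  rw [memSobolev_iff_memLp, show (4 / 2 : ℝ) = (2 : ℕ) by norm_num]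
  simp only [Real.rpow_natCast]
  norm_num

/-- Since `(2πiξ)² = -4π² ξ²`, the weight `1 + ξ²` applied to the transform of `v` gives the
transform of `v - v'' / (4π²)`, which is in `L²`. -/
theorem memSobolev_two_of_deriv_deriv {v : L2}
    (h : MemSobolev 0 2 (derivCLM ℂ (derivCLM ℂ (v : 𝓢'(ℝ, ℂ))))) :
    MemSobolev 2 2 (v : 𝓢'(ℝ, ℂ)) := by
  rw [memSobolev_zero_iff] at h
  obtain ⟨z, hz⟩ := h
  have hs := hasTemperateGrowth_derivSymbol
  rw [← fourier_injective, fourier_derivCLM, fourier_derivCLM, smulLeftCLM_smulLeftCLM_apply hs hs,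
    Lp.fourier_toTemperedDistribution_eq, Lp.fourier_toTemperedDistribution_eq,
    smulLeftCLM_eq_iff (hs.mul hs)] at hz
  rw [memSobolev_two_iff]
  have := (Lp.memLp (𝓕 v : L2)).sub ((Lp.memLp (𝓕 z : L2)).const_mul (1 / (4 * Real.pi ^ 2) : ℂ))
  refine (memLp_congr_ae ?_).1 this
  filter_upwards [hz] with ξ hξ
  have hpi : (Real.pi : ℂ) ≠ 0 := by exact_mod_cast Real.pi_ne_zero
  rw [Pi.sub_apply, hξ, Pi.mul_apply, derivSymbol]
  field_simp
  ring_nf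
  rw [I_sq]
  ring

/-- Multiplication by a smooth function with bounded derivatives preserves `H²`. -/
theorem memSobolev_two_of_isMul {a : ℝ → ℝ} (ha : a.HasTemperateGrowth)
    (ha' : (deriv a).HasTemperateGrowth) (ha'' : (deriv (deriv a)).HasTemperateGrowth)
    (hb : ∃ C, ∀ x, |a x| ≤ C) (hb' : ∃ C, ∀ x, |deriv a x| ≤ C)
    (hb'' : ∃ C, ∀ x, |deriv (deriv a) x| ≤ C) {u v : L2} (huv : IsMul a u v)
    (hu : MemSobolev 2 2 (u : 𝓢'(ℝ, ℂ))) : MemSobolev 2 2 (v : 𝓢'(ℝ, ℂ)) := by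
  have lift {b : ℝ → ℝ} (hb : b.HasTemperateGrowth) :
      (fun x => (b x : ℂ)).HasTemperateGrowth := by fun_prop
  have bound {b : ℝ → ℝ} (hb : ∃ C, ∀ x, |b x| ≤ C) : ∃ C, ∀ x, ‖(b x : ℂ)‖ ≤ C := by simpa
  have hd {b : ℝ → ℝ} (hb : b.HasTemperateGrowth) (x : ℝ) :
      HasDerivAt (fun x => (b x : ℂ)) ((deriv b x : ℝ) : ℂ) x :=
    ((hb.1.differentiable (by simp)) x).hasDerivAt.ofReal_comp
  have hv : smulLeftCLM ℂ (fun x => (a x : ℂ)) (u : 𝓢'(ℝ, ℂ)) = v :=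
    (smulLeftCLM_eq_iff (lift ha) u v).2 huv
  have h1 : MemSobolev 1 2 (derivCLM ℂ (u : 𝓢'(ℝ, ℂ))) :=
    memSobolev_derivCLM (by norm_num; exact hu)
  have h2 : MemSobolev 0 2 (derivCLM ℂ (derivCLM ℂ (u : 𝓢'(ℝ, ℂ)))) :=
    memSobolev_derivCLM (by norm_num; exact h1)
  refine memSobolev_two_of_deriv_deriv ?_
  -- Leibniz: `(a u)'' = a'' u + a' u' + (a' u' + a u'')`, and each term is a bounded function times
  -- an element of `L²`.
  rw [← hv, derivCLM_smulLeftCLM (lift ha) (lift ha') (hd ha), map_add,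
    derivCLM_smulLeftCLM (lift ha') (lift ha'') (hd ha'),
    derivCLM_smulLeftCLM (lift ha) (lift ha') (hd ha)]
  have m0 := memSobolev_zero_smulLeftCLM (lift ha'') (bound hb'') (hu.mono zero_le_two)
  have m1 := memSobolev_zero_smulLeftCLM (lift ha') (bound hb') (h1.mono zero_le_one)
  have m2 := memSobolev_zero_smulLeftCLM (lift ha) (bound hb) h2
  exact (m0.add m1).add (m1.add m2)

/-! ### The resolvent on the Fourier side -/

theorem norm_derivSymbol_le (ξ : ℝ) : ‖derivSymbol ξ‖ ≤ 2 * Real.pi * (1 + ξ ^ 2) := by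
  have h : ‖derivSymbol ξ‖ = 2 * Real.pi * |ξ| := by
    simp [derivSymbol, abs_of_pos Real.pi_pos]
  rw [h]
  have := Real.pi_pos
  gcongr
  rw [abs_le]
  constructor <;> nlinarith [sq_nonneg (ξ - 1), sq_nonneg (ξ + 1)]

theorem norm_derivSymbol_sq_le (ξ : ℝ) : ‖derivSymbol ξ ^ 2‖ ≤ 4 * Real.pi ^ 2 * (1 + ξ ^ 2) := by
  have h : ‖derivSymbol ξ ^ 2‖ = 4 * Real.pi ^ 2 * ξ ^ 2 := by
    simp only [derivSymbol, norm_pow, norm_mul, Complex.norm_ofNat, Complex.norm_real, norm_I,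
      Real.norm_eq_abs, mul_pow, sq_abs]
    norm_num
  rw [h]
  gcongr
  linarith

/-- If the symbol `m` is large compared with `1 + ξ²`, then the equation
`m(∂) u = c u' + (A u)'' + B u + f` has a unique solution `u = S f` in `L²`, where `S` is a bounded
operator. -/
theorem exists_solutionOperator {c : ℝ} {m : ℝ → ℂ} (hm : Continuous m) {A B : L2 →L[ℂ] L2}
    {CA CB : ℝ} (hA : ‖A‖ ≤ CA) (hB : ‖B‖ ≤ CB)
    (hbound : ∀ ξ : ℝ, (4 * (2 * Real.pi * |c| + 4 * Real.pi ^ 2 * CA + CB) + 1) * (1 + ξ ^ 2) ≤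
      ‖m ξ‖) :
    ∃ S : L2 →L[ℂ] L2, ∀ u f : L2, S f = u ↔ ∀ᵐ ξ : ℝ, m ξ * (𝓕 u : L2) ξ =
      c * derivSymbol ξ * (𝓕 u : L2) ξ + derivSymbol ξ ^ 2 * (𝓕 (A u) : L2) ξ +
        (𝓕 (B u) : L2) ξ + (𝓕 f : L2) ξ := by
  have hCA : 0 ≤ CA := (norm_nonneg _).trans hA
  have hCB : 0 ≤ CB := (norm_nonneg _).trans hB
  have hpi := Real.pi_pos
  -- `k` bounds the size of the perturbation relative to `1 + ξ²`. Dividing by `m` leaves norm at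
  -- most `k / (4k + 1) ≤ 1/4`; the summand `1` keeps the denominator positive when `k = 0`.
  set k : ℝ := 2 * Real.pi * |c| + 4 * Real.pi ^ 2 * CA + CB with hk
  have hk0 : 0 ≤ k := by positivity
  have hK : 0 < 4 * k + 1 := by linarith
  have hm0 (ξ : ℝ) : 0 < ‖m ξ‖ := lt_of_lt_of_le (by positivity) (hbound ξ)
  have hm1 (ξ : ℝ) : m ξ ≠ 0 := norm_pos_iff.1 (hm0 ξ)
  have hsc : Continuous derivSymbol := hasTemperateGrowth_derivSymbol.1.continuous
  have quot {x b : ℝ} (ξ : ℝ) (hb : 0 ≤ b) (hx : x ≤ b * (1 + ξ ^ 2)) :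
      x / ‖m ξ‖ ≤ b / (4 * k + 1) := by
    rw [div_le_div_iff₀ (hm0 ξ) hK]
    calc x * (4 * k + 1) ≤ b * (1 + ξ ^ 2) * (4 * k + 1) := by gcongr
      _ = b * ((4 * k + 1) * (1 + ξ ^ 2)) := by ring
      _ ≤ b * ‖m ξ‖ := by gcongr; exact hbound ξ
  obtain ⟨M₁, hM₁, nM₁⟩ := exists_mulOperator (m := fun ξ => c * derivSymbol ξ / m ξ)
    ((by fun_prop : Continuous fun ξ => c * derivSymbol ξ).div hm hm1).aestronglyMeasurable
    (C := 2 * Real.pi * |c| / (4 * k + 1)) (by positivity) (fun ξ => by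
      rw [norm_div]
      refine quot ξ (by positivity) ?_
      rw [norm_mul, Complex.norm_real, Real.norm_eq_abs]
      calc |c| * ‖derivSymbol ξ‖ ≤ |c| * (2 * Real.pi * (1 + ξ ^ 2)) := by
            gcongr; exact norm_derivSymbol_le ξ
        _ = _ := by ring)
  obtain ⟨M₂, hM₂, nM₂⟩ := exists_mulOperator (m := fun ξ => derivSymbol ξ ^ 2 / m ξ)
    ((hsc.pow 2).div hm hm1).aestronglyMeasurable
    (C := 4 * Real.pi ^ 2 / (4 * k + 1)) (by positivity) (fun ξ => by
      rw [norm_div]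
      exact quot ξ (by positivity) (norm_derivSymbol_sq_le ξ))
  obtain ⟨M₃, hM₃, nM₃⟩ := exists_mulOperator (m := fun ξ => 1 / m ξ)
    (continuous_const.div hm hm1).aestronglyMeasurable
    (C := 1 / (4 * k + 1)) (by positivity) (fun ξ => by
      rw [norm_div, norm_one]
      exact quot ξ zero_le_one (by nlinarith [sq_nonneg ξ]))
  let Φ : L2 ≃L[ℂ] L2 := (Lp.fourierTransformₗᵢ ℝ ℂ).toContinuousLinearEquiv
  have hΦ (u : L2) : ‖Φ u‖ = ‖u‖ := (Lp.fourierTransformₗᵢ ℝ ℂ).norm_map u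
  have hΦ' (u : L2) : ‖Φ.symm u‖ = ‖u‖ := (Lp.fourierTransformₗᵢ ℝ ℂ).symm.norm_map u
  let Φ₁ : L2 →L[ℂ] L2 := Φ
  let Φ₂ : L2 →L[ℂ] L2 := Φ.symm
  -- Divided by `m` and transformed back, the equation reads `u - T u = Φ⁻¹ (Φ f / m)`. Both
  -- derivatives of `(A u)''` are absorbed by `1 / m`, so no derivative of the coefficient appears.
  let T : L2 →L[ℂ] L2 := Φ₂ ∘L (M₁ ∘L Φ₁ + M₂ ∘L Φ₁ ∘L A + M₃ ∘L Φ₁ ∘L B)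
  have hTapp (u : L2) : T u = Φ.symm (M₁ (Φ u) + M₂ (Φ (A u)) + M₃ (Φ (B u))) := rfl
  have hT : ‖T‖ < 1 := by
    refine lt_of_le_of_lt (T.opNorm_le_bound (M := 1 / 4) (by norm_num) fun u => ?_) (by norm_num)
    rw [hTapp, hΦ']
    have e₁ : ‖M₁ (Φ u)‖ ≤ 2 * Real.pi * |c| / (4 * k + 1) * ‖u‖ :=
      (M₁.le_of_opNorm_le nM₁ _).trans_eq (by rw [hΦ])
    have e₂ : ‖M₂ (Φ (A u))‖ ≤ 4 * Real.pi ^ 2 / (4 * k + 1) * (CA * ‖u‖) := by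
      refine (M₂.le_of_opNorm_le nM₂ _).trans ?_
      rw [hΦ]
      gcongr
      exact A.le_of_opNorm_le hA u
    have e₃ : ‖M₃ (Φ (B u))‖ ≤ 1 / (4 * k + 1) * (CB * ‖u‖) := by
      refine (M₃.le_of_opNorm_le nM₃ _).trans ?_
      rw [hΦ]
      gcongr
      exact B.le_of_opNorm_le hB u
    calc _ ≤ ‖M₁ (Φ u)‖ + ‖M₂ (Φ (A u))‖ + ‖M₃ (Φ (B u))‖ := norm_add₃_le
      _ ≤ _ := add_le_add (add_le_add e₁ e₂) e₃
      _ = k / (4 * k + 1) * ‖u‖ := by rw [hk]; ring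
      _ ≤ 1 / 4 * ‖u‖ := by
        refine mul_le_mul_of_nonneg_right ?_ (norm_nonneg u)
        rw [div_le_div_iff₀ hK (by norm_num)]
        linarith
  let J := Units.oneSub T hT
  have hJ (u : L2) : (J : L2 →L[ℂ] L2) u = u - T u := rfl
  have hJ₁ (u : L2) : (J : L2 →L[ℂ] L2) ((↑J⁻¹ : L2 →L[ℂ] L2) u) = u :=
    congrArg (fun G : L2 →L[ℂ] L2 => G u) J.mul_inv
  have hJ₂ (u : L2) : (↑J⁻¹ : L2 →L[ℂ] L2) ((J : L2 →L[ℂ] L2) u) = u :=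
    congrArg (fun G : L2 →L[ℂ] L2 => G u) J.inv_mul
  refine ⟨(↑J⁻¹ : L2 →L[ℂ] L2) ∘L Φ₂ ∘L M₃ ∘L Φ₁, fun u f => ?_⟩
  have h1 : ((↑J⁻¹ : L2 →L[ℂ] L2) ∘L Φ₂ ∘L M₃ ∘L Φ₁) f = u ↔ Φ.symm (M₃ (Φ f)) = u - T u := by
    change (↑J⁻¹ : L2 →L[ℂ] L2) (Φ.symm (M₃ (Φ f))) = u ↔ _
    rw [← hJ u]
    exact ⟨fun h => by rw [← h, hJ₁], fun h => by rw [h, hJ₂]⟩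
  rw [h1, hTapp, eq_sub_iff_add_eq, ← map_add, ContinuousLinearEquiv.symm_apply_eq]
  change _ = (𝓕 u : L2) ↔ _
  rw [Lp.ext_iff]
  refine eventually_congr ?_
  filter_upwards [hM₁ (Φ u), hM₂ (Φ (A u)), hM₃ (Φ (B u)), hM₃ (Φ f),
    Lp.coeFn_add (M₃ (Φ f)) (M₁ (Φ u) + M₂ (Φ (A u)) + M₃ (Φ (B u))),
    Lp.coeFn_add (M₁ (Φ u) + M₂ (Φ (A u))) (M₃ (Φ (B u))),
    Lp.coeFn_add (M₁ (Φ u)) (M₂ (Φ (A u)))] with ξ h1 h2 h3 h4 h5 h6 h7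
  rw [h5, Pi.add_apply, h6, Pi.add_apply, h7, Pi.add_apply, h1, h2, h3, h4]
  have hF (u : L2) : Φ u = 𝓕 u := rfl
  simp only [hF]
  have e : 1 / m ξ * (𝓕 f : L2) ξ + (c * derivSymbol ξ / m ξ * (𝓕 u : L2) ξ +
      derivSymbol ξ ^ 2 / m ξ * (𝓕 (A u) : L2) ξ + 1 / m ξ * (𝓕 (B u) : L2) ξ) =
      (c * derivSymbol ξ * (𝓕 u : L2) ξ + derivSymbol ξ ^ 2 * (𝓕 (A u) : L2) ξ +
        (𝓕 (B u) : L2) ξ + (𝓕 f : L2) ξ) / m ξ := by ring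
  rw [e, div_eq_iff (hm1 ξ), eq_comm, mul_comm (m ξ)]

/-- Elliptic regularity: `L²` solutions of the resolvent equation lie in `H⁴`. -/
theorem memSobolev_four_of_fourier_eq {c C : ℝ} {m : ℝ → ℂ} {u v w f : L2}
    (hm : ∀ ξ : ℝ, (1 + ξ ^ 2) ^ 2 ≤ C * ‖m ξ‖)
    (huv : MemSobolev 2 2 (u : 𝓢'(ℝ, ℂ)) → MemSobolev 2 2 (v : 𝓢'(ℝ, ℂ)))
    (h : ∀ᵐ ξ : ℝ, m ξ * (𝓕 u : L2) ξ = c * derivSymbol ξ * (𝓕 u : L2) ξ +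
      derivSymbol ξ ^ 2 * (𝓕 v : L2) ξ + (𝓕 w : L2) ξ + (𝓕 f : L2) ξ) :
    MemSobolev 4 2 (u : 𝓢'(ℝ, ℂ)) := by
  have hC : 0 ≤ C := by
    by_contra hC
    have h1 := hm 0
    have h2 : C * ‖m 0‖ ≤ 0 := mul_nonpos_of_nonpos_of_nonneg (not_le.1 hC).le (norm_nonneg _)
    norm_num at h1
    linarith
  have hn (ξ : ℝ) : ‖(1 + ξ ^ 2 : ℂ)‖ = 1 + ξ ^ 2 := by
    rw [show (1 + ξ ^ 2 : ℂ) = ((1 + ξ ^ 2 : ℝ) : ℂ) by push_cast; rfl, Complex.norm_real,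
      Real.norm_of_nonneg (by positivity)]
  have key : ∀ᵐ ξ : ℝ, (1 + ξ ^ 2) ^ 2 * ‖(𝓕 u : L2) ξ‖ ≤
      C * (2 * Real.pi * |c| * ((1 + ξ ^ 2) * ‖(𝓕 u : L2) ξ‖) +
        4 * Real.pi ^ 2 * ((1 + ξ ^ 2) * ‖(𝓕 v : L2) ξ‖) + ‖(𝓕 w : L2) ξ‖ +
        ‖(𝓕 f : L2) ξ‖) := by
    filter_upwards [h] with ξ hξ
    calc (1 + ξ ^ 2) ^ 2 * ‖(𝓕 u : L2) ξ‖ ≤ C * ‖m ξ‖ * ‖(𝓕 u : L2) ξ‖ := by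
          gcongr; exact hm ξ
      _ = C * ‖m ξ * (𝓕 u : L2) ξ‖ := by rw [norm_mul, mul_assoc]
      _ ≤ _ := by
        rw [hξ]
        gcongr
        refine norm_add_le_of_le (norm_add_le_of_le (norm_add_le_of_le ?_ ?_) le_rfl) le_rfl
        · rw [norm_mul, norm_mul, Complex.norm_real, Real.norm_eq_abs]
          calc |c| * ‖derivSymbol ξ‖ * ‖(𝓕 u : L2) ξ‖
              ≤ |c| * (2 * Real.pi * (1 + ξ ^ 2)) * ‖(𝓕 u : L2) ξ‖ := by
                gcongr; exact norm_derivSymbol_le ξ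
            _ = _ := by ring
        · rw [norm_mul, ← mul_assoc]
          gcongr
          exact norm_derivSymbol_sq_le ξ
  have hmeas (k : ℕ) (u : L2) :
      AEStronglyMeasurable (fun ξ : ℝ => (1 + ξ ^ 2 : ℂ) ^ k * (𝓕 u : L2) ξ) volume :=
    (by fun_prop : Continuous fun ξ : ℝ => (1 + ξ ^ 2 : ℂ) ^ k).aestronglyMeasurable.mul
      (Lp.memLp (𝓕 u : L2)).1
  -- Bootstrap in two rounds. Cancelling one factor `1 + ξ²` in `key` leaves only `L²` functions on
  -- the right, which gives `H²`. Then `huv` puts `v` in `H²` as well, so the right-hand side of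
  -- `key` is itself square integrable.
  have hu : MemSobolev 2 2 (u : 𝓢'(ℝ, ℂ)) := by
    rw [memSobolev_two_iff]
    have dom := (((((Lp.memLp (𝓕 u : L2)).norm.const_mul (2 * Real.pi * |c|)).add
      ((Lp.memLp (𝓕 v : L2)).norm.const_mul (4 * Real.pi ^ 2))).add
      (Lp.memLp (𝓕 w : L2)).norm).add (Lp.memLp (𝓕 f : L2)).norm).const_mul C
    refine dom.mono' (by simpa using hmeas 1 u) ?_
    filter_upwards [key] with ξ hξ
    simp only [Pi.add_apply]
    rw [norm_mul, hn]
    have h1 : 1 ≤ 1 + ξ ^ 2 := by nlinarith [sq_nonneg ξ]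
    have h0 : 0 < 1 + ξ ^ 2 := by linarith
    refine le_of_mul_le_mul_left ?_ h0
    calc (1 + ξ ^ 2) * ((1 + ξ ^ 2) * ‖(𝓕 u : L2) ξ‖)
        = (1 + ξ ^ 2) ^ 2 * ‖(𝓕 u : L2) ξ‖ := by ring
      _ ≤ _ := hξ
      _ ≤ C * (2 * Real.pi * |c| * ((1 + ξ ^ 2) * ‖(𝓕 u : L2) ξ‖) +
        4 * Real.pi ^ 2 * ((1 + ξ ^ 2) * ‖(𝓕 v : L2) ξ‖) + (1 + ξ ^ 2) * ‖(𝓕 w : L2) ξ‖ +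
        (1 + ξ ^ 2) * ‖(𝓕 f : L2) ξ‖) := by
          gcongr
          · exact le_mul_of_one_le_left (norm_nonneg _) h1
          · exact le_mul_of_one_le_left (norm_nonneg _) h1
      _ = _ := by ring
  rw [memSobolev_four_iff]
  have dom := ((((((memSobolev_two_iff u).1 hu).norm.const_mul (2 * Real.pi * |c|)).add
    (((memSobolev_two_iff v).1 (huv hu)).norm.const_mul (4 * Real.pi ^ 2))).add
    (Lp.memLp (𝓕 w : L2)).norm).add (Lp.memLp (𝓕 f : L2)).norm).const_mul C
  refine dom.mono' (hmeas 2 u) ?_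
  filter_upwards [key] with ξ hξ
  simp only [Pi.add_apply]
  rwa [norm_mul, norm_pow, norm_mul, norm_mul, hn]

/-- The point `z + 1` has positive real part, so it makes an acute angle with `r ≥ 0` and `‖z + 1 +
r‖² ≥ ‖z + 1‖² + r²`. Undoing the shift gives `‖z + r‖ ≥ (‖z‖ + r) / 2 - 3/2`, and the threshold `6`
is what absorbs the `3/2`. -/
theorem norm_add_ofReal_ge {z : ℂ} (hz : -1 < z.re) (hz' : 6 ≤ ‖z‖) {r : ℝ} (hr : 0 ≤ r) :
    (‖z‖ + r) / 4 ≤ ‖z + r‖ := by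
  have h1 : (‖z + 1‖ + r) / 2 ≤ ‖z + 1 + r‖ := by
    refine abs_le_of_sq_le_sq' ?_ (norm_nonneg _) |>.2
    have e1 : ‖z + 1 + r‖ ^ 2 = ‖z + 1‖ ^ 2 + 2 * (z.re + 1) * r + r ^ 2 := by
      rw [Complex.sq_norm, Complex.sq_norm, Complex.normSq_apply, Complex.normSq_apply]
      simp
      ring
    have : 0 ≤ (z.re + 1) * r := mul_nonneg (by linarith) hr
    nlinarith [sq_nonneg (‖z + 1‖ - r), sq_nonneg (‖z + 1‖ + r), sq_nonneg ‖z + 1‖]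
  have h2 : ‖z‖ - 1 ≤ ‖z + 1‖ := by simpa using norm_sub_norm_le z (-1)
  have h3 : ‖z + 1 + r‖ ≤ ‖z + r‖ + 1 := by
    rw [show z + 1 + r = z + r + 1 by ring]
    simpa using norm_add_le (z + r) 1
  linarith

/-! ### The resolvent set of the linearised operator. -/

section

variable {ε c : ℝ} {U W P V : ℝ → ℝ}

/-- Large points to the right of the line `Re z = -1` belong to the resolvent set. -/
theorem IsTravellingWave.exists_resolventSet (hε : 0 < ε) (h : IsTravellingWave ε c U W P V) :
    ∃ M : ℝ, 0 < M ∧ ∀ z : ℂ, -1 < z.re → M ≤ ‖z‖ →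
      z ∈ resolventSet (linearisedOperator ε c U) := by
  have hpi := Real.pi_pos
  have ma : (fun ζ => diffusion (U ζ)) ∈ waveAlgebra U W P V := diffusion_mem_waveAlgebra
  have mb : (fun ζ => deriv reaction (U ζ)) ∈ waveAlgebra U W P V := deriv_reaction_mem_waveAlgebra
  have ma' := (h.differentiable hε ma).2
  have ma'' := (h.differentiable hε ma').2
  have ops {b : ℝ → ℝ} (hb : b ∈ waveAlgebra U W P V) :
      ∃ A : L2 →L[ℂ] L2, ∀ u, IsMul b u (A u) := by
    obtain ⟨C, hC⟩ := h.bounded hε hb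
    have hc : Continuous b := (h.differentiable hε hb).1.continuous
    obtain ⟨A, hA, -⟩ := exists_mulOperator (m := fun x => (b x : ℂ))
      (by fun_prop : Continuous fun x => (b x : ℂ)).aestronglyMeasurable
      ((abs_nonneg _).trans (hC 0)) (by simpa using hC)
    exact ⟨A, hA⟩
  obtain ⟨A, hA⟩ := ops ma
  obtain ⟨B, hB⟩ := ops mb
  have uniq {b : ℝ → ℝ} {u v v' : L2} (hv : IsMul b u v) (hv' : IsMul b u v') : v = v' := by
    refine Lp.ext ?_
    filter_upwards [hv, hv'] with x h1 h2
    rw [h1, h2]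
  set K : ℝ := 4 * (2 * Real.pi * |c| + 4 * Real.pi ^ 2 * ‖A‖ + ‖B‖) + 1 with hK
  have hK0 : 0 < K := by positivity
  -- As `i⁴ = 1`, the symbol of `ε² ∂⁴` is `e ξ⁴`, which is real and nonnegative.
  set e : ℝ := ε ^ 2 * (2 * Real.pi) ^ 4 with he
  have he0 : 0 < e := by positivity
  -- The `6` is the threshold of `norm_add_ofReal_ge`, and the factor `4` offsets its `1/4`. The
  -- term `K² / e` comes from completing the square: `K ξ² ≤ K² / e + e ξ⁴ / 4`.
  refine ⟨6 + 4 * (K + K ^ 2 / e), by positivity, fun z hz hzM => ?_⟩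
  have hz6 : 6 ≤ ‖z‖ := le_trans (by nlinarith [div_pos (pow_pos hK0 2) he0]) hzM
  set m : ℝ → ℂ := fun ξ => z + ((e * ξ ^ 4 : ℝ) : ℂ) with hm
  have hmlow (ξ : ℝ) : (‖z‖ + e * ξ ^ 4) / 4 ≤ ‖m ξ‖ :=
    norm_add_ofReal_ge hz hz6 (by positivity)
  have hbound (ξ : ℝ) : K * (1 + ξ ^ 2) ≤ ‖m ξ‖ := by
    refine le_trans ?_ (hmlow ξ)
    have e1 : K * ξ ^ 2 ≤ K ^ 2 / e + e * ξ ^ 4 / 4 := by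
      have : K ^ 2 / e + e * ξ ^ 4 / 4 - K * ξ ^ 2 = (K - e * ξ ^ 2 / 2) ^ 2 / e := by
        field_simp; ring
      have h0 : 0 ≤ (K - e * ξ ^ 2 / 2) ^ 2 / e := by positivity
      linarith
    linarith
  -- From `(1 + ξ²)² ≤ 2 + 2 ξ⁴`: with `‖m ξ‖ ≥ (6 + e ξ⁴) / 4`, the coefficient `8 / e` supplies `2
  -- ξ⁴` and the `2` supplies the constant.
  have hfour (ξ : ℝ) : (1 + ξ ^ 2) ^ 2 ≤ (2 + 8 / e) * ‖m ξ‖ := by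
    have e1 : (6 + e * ξ ^ 4) / 4 ≤ ‖m ξ‖ := le_trans (by linarith) (hmlow ξ)
    refine le_trans ?_ (mul_le_mul_of_nonneg_left e1 (by positivity))
    have e2 : (2 + 8 / e) * ((6 + e * ξ ^ 4) / 4) = 3 + e * ξ ^ 4 / 2 + 12 / e + 2 * ξ ^ 4 := by
      field_simp; ring
    rw [e2]
    have h1 : 0 ≤ e * ξ ^ 4 / 2 := by positivity
    have h2 : 0 ≤ 12 / e := by positivity
    nlinarith [sq_nonneg (ξ ^ 2 - 1)]
  have hmc : Continuous m := by fun_prop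
  have hms (ξ : ℝ) : m ξ = z + ε ^ 2 * derivSymbol ξ ^ 4 := by
    simp only [hm, he, derivSymbol, mul_pow, I_pow_four]
    push_cast
    ring
  obtain ⟨S, hS⟩ := exists_solutionOperator (c := c) hmc (le_refl ‖A‖) (le_refl ‖B‖) hbound
  have hF (u g : L2) : ∀ᵐ ξ : ℝ, (𝓕 (z • u - g) : L2) ξ = z * (𝓕 u : L2) ξ - (𝓕 g : L2) ξ := by
    have e1 : (𝓕 (z • u - g) : L2) = z • (𝓕 u : L2) - 𝓕 g := by
      rw [← FourierTransform.fourier_smul]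
      exact map_sub (Lp.fourierTransformₗᵢ ℝ ℂ) (z • u) g
    rw [e1]
    filter_upwards [Lp.coeFn_sub (z • (𝓕 u : L2)) (𝓕 g), Lp.coeFn_smul z (𝓕 u : L2)] with ξ h1 h2
    rw [h1, Pi.sub_apply, h2, Pi.smul_apply, smul_eq_mul]
  -- This equivalence contains both resolvent identities: take `u = S f`, `g = z S f - f` for the
  -- right inverse, and `g = L u` for the left inverse.
  have hsolve (u g : L2) : IsLinearised ε c U u g ↔ S (z • u - g) = u := by
    rw [isLinearised_iff, hS]
    constructor
    · rintro ⟨-, v, w, hv, hw, hg⟩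
      rw [uniq hv (hA u), uniq hw (hB u)] at hg
      filter_upwards [hg, hF u g] with ξ h1 h2
      rw [h2, h1, hms]
      ring
    · intro hu
      refine ⟨memSobolev_four_of_fourier_eq hfour (fun h2 => memSobolev_two_of_isMul
        (h.hasTemperateGrowth hε ma) (h.hasTemperateGrowth hε ma') (h.hasTemperateGrowth hε ma'')
        (h.bounded hε ma) (h.bounded hε ma') (h.bounded hε ma'') (hA u) h2) hu,
        A u, B u, hA u, hB u, ?_⟩
      filter_upwards [hu, hF u g] with ξ h1 h2
      rw [h2, hms] at h1
      linear_combination h1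
  refine ⟨S, fun f => ?_, fun u => ?_⟩
  · have hg : (S f, z • S f - f) ∈ (linearisedOperator ε c U).graph := by
      rw [mem_graph_linearisedOperator, hsolve, sub_sub_cancel]
    obtain ⟨y, hy, hy'⟩ := (LinearPMap.mem_graph_iff _).1 hg
    have hd : S f ∈ (linearisedOperator ε c U).domain := by
      have h1 : (y : L2) = S f := hy
      exact h1 ▸ y.2
    refine ⟨hd, ?_⟩
    rw [show (⟨S f, hd⟩ : (linearisedOperator ε c U).domain) = y from Subtype.ext hy.symm, hy',
      sub_sub_cancel]
  · exact (hsolve _ _).1 ((mem_graph_linearisedOperator ε c U _ _).1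
      ((linearisedOperator ε c U).mem_graph u))

end

end ShockFront

/-! ### Conclusion: the half-plane `Re z > -1` and a circle about the origin. -/

theorem mainTheorem2 (ε c : ℝ) (hε : 0 < ε) (U W P V : ℝ → ℝ)
    (hwave : ShockFront.IsTravellingWave ε c U W P V) :
    ∃ β : ℝ, β < 0 ∧ ∃ K : Set ℂ, ShockFront.IsSimpleClosedCurve K ∧
      ShockFront.spectrum (ShockFront.linearisedOperator ε c U) ∩ {z : ℂ | β < z.re} ⊆
        ShockFront.curveInterior K ∧
      ShockFront.pointSpectrum (ShockFront.linearisedOperator ε c U) ∩ {z : ℂ | β < z.re} ⊆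
        ShockFront.curveInterior K := by
  obtain ⟨M, hM, hres⟩ := hwave.exists_resolventSet hε
  have hspec : ShockFront.spectrum (ShockFront.linearisedOperator ε c U) ∩ {z : ℂ | -1 < z.re} ⊆
      ShockFront.curveInterior (Metric.sphere 0 M) := by
    rintro z ⟨hz, hz'⟩
    refine ShockFront.ball_subset_curveInterior_sphere M ?_
    rw [mem_ball_zero_iff]
    by_contra hzM
    exact hz (hres z hz' (not_lt.1 hzM))
  exact ⟨-1, by norm_num, _, ShockFront.isSimpleClosedCurve_sphere hM, hspec,
    (Set.inter_subset_inter_left _ (ShockFront.pointSpectrum_subset_spectrum _)).trans hspec⟩
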